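/- Let $\mathbb K=\mathbb R$ or $\mathbb C$, and let $c_0=c_0(\mathbb N_0)$ be the Banach space of null sequences $(x_n)_{n\ge 0}$ in $\mathbb K$ with the supremum norm. For a sequence $w=(w_n)_{n\ge1}$ of non-zero scalars, the weighted backward shift is $B_w((x_n)_{n\ge0})=(w_{n+1}x_{n+1})_{n\ge0}$. For $A\subset\mathbb N_0$ let $\underline{\mathrm{dens}}\,A=\liminf_{N\to\infty}\frac{1}{N+1}\operatorname{card}(A\cap[0,N])$ and $A-n=\{k-n: k\in A,\ k\ge n\}$, and let $\mathcal A_{\mathrm{Hin}}$ be Hindman's family of all $A\subset \mathbb N_0$ with $$\lim_{N\to\infty}\underline{\mathrm{dens}}\bigcup_{n=0}^N (A-n)=1 .$$ A continuous map $T:X\to X$ is called very frequently hypercyclic if there is a point $x\in X$ such that $\{n\ge0: T^nx\in U\}\in\mathcal A_{\mathrm{Hin}}$ for every non-empty open set $U\subset X$; it is called chaotic if it has a dense orbit $\{T^nx:n\geq 0\}$ and a dense set of periodic points; and it is called mixing if for all non-empty open sets $U,V\subset X$ there is some $N$ with $T^n(U)\cap V\neq\varnothing$ for all $n\ge N$.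 **Theorem.** There exists a weighted backward shift $B_w$ that is a bounded operator on $c_0$ and is very frequently hypercyclic but not chaotic. In particular, $B_w$ has no eigenvalue $\lambda\in\mathbb K$ with $|\lambda|=1$, it is not mixing, and it admits no non-trivial invariant Gaussian measure: the only Gaussian Borel measure on $c_0$ that is invariant under $B_w$ is the Dirac measure at $0$. (A Borel measure on $c_0$ is Gaussian if every continuous real-linear functional has a, possibly degenerate, real normal distribution under it.) -/

import Mathlib

open Filter Topology MeasureTheory ProbabilityTheory
open scoped ZeroAtInfty

namespace LinearDynamics

/-- The lower density `liminf_{N → ∞} card (A ∩ [0, N]) / (N + 1)` of a set of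
non-negative integers. -/
noncomputable def lowerDensity (A : Set ℕ) : ℝ :=
  liminf (fun N : ℕ => ((A ∩ Set.Icc 0 N).ncard : ℝ) / ((N : ℝ) + 1)) atTop

/-- The translate `A - n = {k - n : k ∈ A, k ≥ n}`. -/
def leftTranslate (A : Set ℕ) (n : ℕ) : Set ℕ := {k | k + n ∈ A}

/-- Hindman's family: the sets `A` such that the lower density of
`(A - 0) ∪ (A - 1) ∪ ... ∪ (A - N)` tends to `1` as `N → ∞`. -/
def hindmanFamily : Set (Set ℕ) :=
  {A | Tendsto (fun N : ℕ => lowerDensity (⋃ n ∈ Set.Icc 0 N, leftTranslate A n)) atTop (𝓝 1)}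

section Dynamics

variable {X : Type*} [TopologicalSpace X]

/-- `T` is `𝒜`-hypercyclic, for a family `𝒜` of sets of non-negative integers. -/
def IsFamilyHypercyclic (𝒜 : Set (Set ℕ)) (T : X → X) : Prop :=
  ∃ x : X, ∀ U : Set X, IsOpen U → U.Nonempty → {n : ℕ | T^[n] x ∈ U} ∈ 𝒜

/-- Very frequent hypercyclicity is hypercyclicity with respect to Hindman's family. -/
def IsVeryFrequentlyHypercyclic (T : X → X) : Prop :=
  IsFamilyHypercyclic hindmanFamily T

/-- `T` is hypercyclic: some point has a dense orbit. -/
def IsHypercyclic (T : X → X) : Prop :=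
  ∃ x : X, Dense (Set.range fun n : ℕ => T^[n] x)

/-- `T` is chaotic: it is hypercyclic and its periodic points are dense. -/
def IsChaotic (T : X → X) : Prop :=
  IsHypercyclic T ∧ Dense (Function.periodicPts T)

/-- `T` is (topologically) mixing. -/
def IsTopologicallyMixing (T : X → X) : Prop :=
  ∀ U V : Set X, IsOpen U → U.Nonempty → IsOpen V → V.Nonempty →
    ∃ N : ℕ, ∀ n ≥ N, (T^[n] '' U ∩ V).Nonempty

end Dynamics

/-- The operator `T` on `c₀` (the continuous functions on the discrete space `ℕ` that vanish at
infinity) is the weighted backward shift `(x_n)_{n ≥ 0} ↦ (w_{n+1} x_{n+1})_{n ≥ 0}` for the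
sequence `(w_n)_{n ≥ 1}` of non-zero scalars; the value `w 0` plays no role. -/
def IsWeightedBackwardShift {𝕜 : Type*} [RCLike 𝕜] (w : ℕ → 𝕜)
    (T : C₀(ℕ, 𝕜) →L[𝕜] C₀(ℕ, 𝕜)) : Prop :=
  (∀ n : ℕ, 1 ≤ n → w n ≠ 0) ∧ ∀ (x : C₀(ℕ, 𝕜)) (n : ℕ), T x n = w (n + 1) * x (n + 1)

end LinearDynamics

namespace LinearDynamics

/-! After division by the weight products `W n`, the shift acts as the plain shift on coordinates `W
n * x n`. Let `W` double at each step and drop back to `1` at sparse reset times `b k`. Since `W (b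
k + s) ≤ 2 ^ s` uniformly in `k`, coordinates tend to `0` along every shifted reset sequence
(`tendsto_coordinate_resetTime`). This excludes unimodular eigenvalues, nonzero periodic points,
mixing and every invariant probability measure other than the Dirac measure at `0`.

For hypercyclicity, a vector carries a copy of the `p`-th target at each time of `returnSet p`. Seen
from a return time of index `q`, every later block must lie where `W` is at least `4 ^ max p q`,
that is, far after the last reset (`le_elapsed_sub`). This is arithmetic: reset times of index at
least `q` are all congruent to `b q` modulo `modulus q`, so a difference of return times avoids them
once neighbourhoods of `± b i` modulo the larger moduli are removed.

The removed sets are thin, and the residue `2 * (b q - b p)` avoids them (`not_mem_forbidden`). So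
outside a set of small density every time is followed, within a bounded gap, by a return time; this
is membership in Hindman's family (`mem_hindmanFamily_of_returnSet_subset`). -/

/-! ### The moduli and the reset times -/

/-- A rapidly growing sequence of moduli, each dividing the next. -/
def modulus : ℕ → ℕ
  | 0 => 16
  -- The factor `16 * (q + 2) ^ 2` pays for the size of `forbidden (q + 1)` per period, `2 ^ (q +
  -- 1)` makes the densities summable, and the square absorbs the `2 * modulus q + 1` translates in
  -- `ncard_near_forbidden_le`.
  | q + 1 => modulus q ^ 2 * (16 * (q + 2) ^ 2 * 2 ^ (q + 1))

/-- The times at which the weight products are reset to `1`. -/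
def resetTime (k : ℕ) : ℕ := ∑ j ∈ Finset.range k, modulus j

lemma resetTime_zero : resetTime 0 = 0 := rfl

lemma resetTime_succ (k : ℕ) : resetTime (k + 1) = resetTime k + modulus k :=
  Finset.sum_range_succ _ _

lemma modulus_succ (q : ℕ) :
    modulus (q + 1) = modulus q ^ 2 * (16 * (q + 2) ^ 2 * 2 ^ (q + 1)) := rfl

lemma modulus_dvd_succ (q : ℕ) : modulus q ∣ modulus (q + 1) :=
  ⟨modulus q * (16 * (q + 2) ^ 2 * 2 ^ (q + 1)), by rw [modulus_succ]; ring⟩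

lemma modulus_dvd {q r : ℕ} (h : q ≤ r) : modulus q ∣ modulus r := by
  induction r, h using Nat.le_induction with
  | base => exact dvd_rfl
  | succ r _ ih => exact ih.trans (modulus_dvd_succ r)

lemma resetTime_le_modulus (q : ℕ) : 8 * resetTime q + 16 * (q + 1) ≤ modulus q := by
  induction q with
  | zero => simp [resetTime, modulus]
  | succ q ih =>
    have h1 : 16 ≤ modulus q := by omega
    have h2 : 1 ≤ (q + 2) ^ 2 * 2 ^ (q + 1) := Nat.one_le_iff_ne_zero.2 (by positivity)
    have h3 : modulus (q + 1) = modulus q * modulus q * (16 * ((q + 2) ^ 2 * 2 ^ (q + 1))) := by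
      rw [modulus_succ]; ring
    have h4 : modulus q * 16 * (16 * 1) ≤ modulus (q + 1) := by rw [h3]; gcongr
    rw [resetTime_succ]
    omega

lemma modulus_pos (q : ℕ) : 0 < modulus q := by
  have := resetTime_le_modulus q
  omega

lemma le_resetTime {q : ℕ} (hq : 1 ≤ q) : 16 * q ≤ resetTime q := by
  obtain ⟨r, rfl⟩ := Nat.exists_eq_add_of_le' hq
  have := resetTime_le_modulus r
  rw [resetTime_succ]
  omega

lemma resetTime_strictMono : StrictMono resetTime :=
  strictMono_nat_of_lt_succ fun k => by
    have := modulus_pos k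
    rw [resetTime_succ]; omega

lemma resetTime_eq_add_mul {q k : ℕ} (h : q ≤ k) :
    ∃ l, resetTime k = resetTime q + l * modulus q := by
  induction k, h using Nat.le_induction with
  | base => exact ⟨0, by simp⟩
  | succ k hk ih =>
    obtain ⟨l, hl⟩ := ih
    obtain ⟨c, hc⟩ := modulus_dvd hk
    exact ⟨l + c, by rw [resetTime_succ, hl, hc]; ring⟩

lemma mul_ne_mul_add {N a c r : ℕ} (h0 : 0 < r) (h1 : r < N) : a * N ≠ c * N + r := by
  intro h
  have h2 : c < a := Nat.lt_of_mul_lt_mul_right (a := N) (by omega)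
  have h3 : (c + 1) * N ≤ a * N := Nat.mul_le_mul_right _ h2
  rw [add_mul] at h3
  omega

/-! ### The distance to the last reset time -/

/-- The last reset time that is at most `n`. -/
noncomputable def lastReset (n : ℕ) : ℕ :=
  @Nat.findGreatest (fun m => ∃ k, resetTime k = m) (Classical.decPred _) n

/-- The time elapsed since the last reset. -/
noncomputable def elapsed (n : ℕ) : ℕ := n - lastReset n

lemma lastReset_le (n : ℕ) : lastReset n ≤ n :=
  @Nat.findGreatest_le _ (Classical.decPred _) n

lemma exists_resetTime_eq_lastReset (n : ℕ) : ∃ k, resetTime k = lastReset n := by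
  exact @Nat.findGreatest_spec _ (fun m => ∃ k, resetTime k = m) (Classical.decPred _) _
    (Nat.zero_le n) ⟨0, resetTime_zero⟩

lemma resetTime_le_lastReset {k n : ℕ} (h : resetTime k ≤ n) : resetTime k ≤ lastReset n := by
  exact @Nat.le_findGreatest _ _ (Classical.decPred _) _ h ⟨k, rfl⟩

lemma exists_eq_resetTime_add_elapsed (n : ℕ) :
    ∃ k, n = resetTime k + elapsed n ∧ ∀ K, resetTime K ≤ n → K ≤ k := by
  obtain ⟨k, hk⟩ := exists_resetTime_eq_lastReset n
  refine ⟨k, ?_, fun K hK => ?_⟩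
  · have := lastReset_le n
    rw [hk, elapsed]; omega
  · have := resetTime_le_lastReset hK
    rw [← hk] at this
    exact resetTime_strictMono.le_iff_le.1 this

lemma elapsed_le (n : ℕ) : elapsed n ≤ n := Nat.sub_le _ _

lemma elapsed_succ_le (n : ℕ) : elapsed (n + 1) ≤ elapsed n + 1 := by
  have h1 := lastReset_le n
  obtain ⟨k, hk⟩ := exists_resetTime_eq_lastReset n
  have h2 := resetTime_le_lastReset (k := k) (n := n + 1) (by omega)
  unfold elapsed
  omega

lemma elapsed_resetTime (k : ℕ) : elapsed (resetTime k) = 0 := by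
  have := resetTime_le_lastReset (le_refl (resetTime k))
  unfold elapsed
  omega

/-! ### The return sets -/

/-- The naturals within distance `2 * q` of some `j * modulus q ± resetTime i` with
`1 ≤ j` and `i ≤ q`. -/
def forbidden (q : ℕ) : Set ℕ :=
  {m | ∃ j ≥ 1, ∃ i ≤ q,
    (j * modulus q + resetTime i ≤ m + 2 * q ∧ m ≤ j * modulus q + resetTime i + 2 * q) ∨
    (j * modulus q ≤ m + resetTime i + 2 * q ∧ m + resetTime i ≤ j * modulus q + 2 * q)}

/-- The positive multiples of `modulus p` outside of the forbidden sets of larger index. -/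
def returnSet (p : ℕ) : Set ℕ :=
  {m | (∃ j ≥ 1, m = j * modulus p) ∧ ∀ q, p < q → m ∉ forbidden q}

lemma returnSet_disjoint {p q m : ℕ} (h : p < q) (hp : m ∈ returnSet p) : m ∉ returnSet q := by
  rintro ⟨⟨j, hj, rfl⟩, -⟩
  exact hp.2 q h ⟨j, hj, 0, Nat.zero_le _, Or.inl ⟨by rw [resetTime_zero]; omega, by omega⟩⟩

/-- A reset of index at least `p` just before `m - n + t` would force the residue `b p + d - t`
modulo `modulus p`, with `d < 2 * p`, to vanish; but it lies strictly between `0` and `modulus p`.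
Earlier resets are too small to be close. -/
lemma le_elapsed_sub_self {p m n t : ℕ} (hp : 1 ≤ p) (hm : m ∈ returnSet p)
    (hn : n ∈ returnSet p) (hnm : n < m) (ht : t ≤ p) : 2 * p ≤ elapsed (m - n + t) := by
  by_contra! hd
  obtain ⟨k, hk, -⟩ := exists_eq_resetTime_add_elapsed (m - n + t)
  set d := elapsed (m - n + t)
  obtain ⟨⟨j, hj, rfl⟩, -⟩ := hm
  obtain ⟨⟨j', hj', rfl⟩, -⟩ := hn
  have hN := resetTime_le_modulus p
  have hb := le_resetTime hp
  rcases le_total k p with hkp | hkp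
  · have := resetTime_strictMono.monotone hkp
    have h2 : j' < j := Nat.lt_of_mul_lt_mul_right hnm
    have h3 : (j' + 1) * modulus p ≤ j * modulus p := Nat.mul_le_mul_right _ h2
    rw [add_mul] at h3
    omega
  · obtain ⟨l, hl⟩ := resetTime_eq_add_mul hkp
    refine mul_ne_mul_add (N := modulus p) (a := j) (c := j' + l) (r := resetTime p + d - t)
      (by omega) (by omega) ?_
    rw [add_mul]
    omega

/-- Here `n` is a multiple of `modulus q`, so closeness to a reset puts `m` near a multiple plus
some `b i`: the plus sign in `forbidden q`. -/
lemma le_elapsed_sub_of_lt {p q m n t : ℕ} (hpq : p < q) (hm : m ∈ returnSet p)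
    (hn : n ∈ returnSet q) (hnm : n < m) (ht : t ≤ p) : 2 * q ≤ elapsed (m - n + t) := by
  by_contra! hd
  obtain ⟨k, hk, -⟩ := exists_eq_resetTime_add_elapsed (m - n + t)
  set d := elapsed (m - n + t)
  obtain ⟨⟨j, hj, rfl⟩, -⟩ := hn
  apply hm.2 q hpq
  rcases le_total k q with hkq | hkq
  · exact ⟨j, hj, k, hkq, Or.inl ⟨by omega, by omega⟩⟩
  · obtain ⟨l, hl⟩ := resetTime_eq_add_mul hkq
    exact ⟨j + l, by omega, q, le_rfl, Or.inl ⟨by rw [add_mul]; omega, by rw [add_mul]; omega⟩⟩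

/-- Now `m` is the multiple of the larger modulus, and `n` would be near a multiple minus some `b
i`: the minus sign in `forbidden p`. -/
lemma le_elapsed_sub_of_gt {p q m n t : ℕ} (hqp : q < p) (hm : m ∈ returnSet p)
    (hn : n ∈ returnSet q) (hnm : n < m) (ht : t ≤ p) : 2 * p ≤ elapsed (m - n + t) := by
  by_contra! hd
  obtain ⟨k, hk, -⟩ := exists_eq_resetTime_add_elapsed (m - n + t)
  set d := elapsed (m - n + t)
  obtain ⟨⟨j, hj, rfl⟩, -⟩ := hm
  have hb := le_resetTime (q := p) (by omega)
  apply hn.2 p hqp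
  rcases le_total k p with hkp | hkp
  · exact ⟨j, hj, k, hkp, Or.inr ⟨by omega, by omega⟩⟩
  · obtain ⟨l, hl⟩ := resetTime_eq_add_mul hkp
    have h2 : l < j := Nat.lt_of_mul_lt_mul_right (a := modulus p) (by omega)
    obtain ⟨c, rfl⟩ := Nat.exists_eq_add_of_lt h2
    have h3 : (l + c + 1) * modulus p = l * modulus p + (c + 1) * modulus p := by ring
    exact ⟨c + 1, by omega, p, le_rfl, Or.inr ⟨by omega, by omega⟩⟩

lemma le_elapsed_sub {p q m n t : ℕ} (hp : 1 ≤ p) (hm : m ∈ returnSet p)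
    (hn : n ∈ returnSet q) (hnm : n < m) (ht : t ≤ p) :
    2 * max p q ≤ elapsed (m - n + t) := by
  rcases lt_trichotomy p q with h | rfl | h
  · rw [max_eq_right h.le]; exact le_elapsed_sub_of_lt h hm hn hnm ht
  · rw [max_self]; exact le_elapsed_sub_self hp hm hn hnm ht
  · rw [max_eq_left h.le]; exact le_elapsed_sub_of_gt h hm hn hnm ht

/-- The blocks `m + [0, p]`, `m ∈ returnSet p`, are pairwise disjoint. -/
lemma returnSet_block_unique {p q m n s t : ℕ} (hp : 1 ≤ p) (hq : 1 ≤ q) (hm : m ∈ returnSet p)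
    (hn : n ∈ returnSet q) (ht : t ≤ p) (hs : s ≤ q) (h : m + t = n + s) :
    p = q ∧ m = n ∧ t = s := by
  have key : ∀ {p q m n s t : ℕ}, 1 ≤ p → 1 ≤ q → m ∈ returnSet p → n ∈ returnSet q →
      t ≤ p → s ≤ q → m + t = n + s → m ≤ n := by
    intro p q m n s t hp hq hm hn ht hs h
    by_contra! hlt
    -- Here `m - n + t = s ≤ q`, too small to have elapsed time `2 * q`.
    have h1 := le_elapsed_sub hp hm hn hlt ht
    have h2 := elapsed_le (m - n + t)
    have h3 := le_max_right p q
    omega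
  have hmn : m = n := le_antisymm (key hp hq hm hn ht hs h) (key hq hp hn hm hs ht h.symm)
  subst hmn
  refine ⟨?_, rfl, by omega⟩
  rcases lt_trichotomy p q with h | h | h
  · exact absurd hn (returnSet_disjoint h hm)
  · exact h
  · exact absurd hm (returnSet_disjoint h hn)

/-- The term `k - 1` makes the hypercyclic vector a null sequence. It arises because `b (r + 1) =
modulus r + b r` is covered by `forbidden r` with `j = 1`. -/
lemma le_elapsed {p m t k : ℕ} (hp : 1 ≤ p) (hm : m ∈ returnSet p) (ht : t ≤ p)
    (hk : m + t = resetTime k + elapsed (m + t)) : 2 * max p (k - 1) ≤ elapsed (m + t) := by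
  by_contra! hd
  set d := elapsed (m + t)
  have hN := resetTime_le_modulus p
  have hb := le_resetTime hp
  obtain ⟨⟨j, hj, hmj⟩, hF⟩ := hm
  rcases lt_trichotomy k (p + 1) with hkp | rfl | hkp
  · rw [max_eq_left (by omega)] at hd
    have := resetTime_strictMono.monotone (Nat.lt_succ_iff.1 hkp)
    have h3 : 1 * modulus p ≤ j * modulus p := Nat.mul_le_mul_right _ hj
    omega
  · rw [max_eq_left (by omega)] at hd
    rw [resetTime_succ] at hk
    exact mul_ne_mul_add (N := modulus p) (a := j) (c := 1) (r := resetTime p + d - t)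
      (by omega) (by omega) (by omega)
  · obtain ⟨r, rfl⟩ : ∃ r, k = r + 1 := ⟨k - 1, by omega⟩
    rw [Nat.add_sub_cancel, max_eq_right (by omega)] at hd
    rw [resetTime_succ] at hk
    exact hF r (by omega) ⟨1, le_rfl, r, le_rfl, Or.inl ⟨by omega, by omega⟩⟩

/-! ### Counting -/

lemma mul_modulus_le_of_mem {q m j i : ℕ} (hi : i ≤ q)
    (h : j * modulus q ≤ m + resetTime i + 2 * q) (hj : 1 ≤ j) : j * modulus q ≤ 2 * m := by
  have h1 := resetTime_le_modulus q
  have h2 := resetTime_strictMono.monotone hi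
  have h3 : 1 * modulus q ≤ j * modulus q := Nat.mul_le_mul_right _ hj
  omega

lemma index_le_of_mem_forbidden {q m : ℕ} (h : m ∈ forbidden q) : q ≤ m := by
  obtain ⟨j, hj, i, hi, h⟩ := h
  have h1 := mul_modulus_le_of_mem (m := m) hi (by omega) hj
  have h2 := resetTime_le_modulus q
  have h3 : 1 * modulus q ≤ j * modulus q := Nat.mul_le_mul_right _ hj
  omega

lemma modulus_mul_ncard_forbidden_le (q M : ℕ) :
    modulus q * (forbidden q ∩ Set.Icc 0 M).ncard ≤ 16 * (q + 1) ^ 2 * M := by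
  classical
  -- Codes: the multiple `j`, the reset index `i`, the offset in a window of `4 * q + 1` points, and
  -- the sign.
  let S : Finset (ℕ × ℕ × ℕ × Bool) := Finset.Icc 1 (2 * M / modulus q) ×ˢ
    (Finset.range (q + 1) ×ˢ (Finset.range (4 * q + 1) ×ˢ Finset.univ))
  let f : ℕ × ℕ × ℕ × Bool → ℕ := fun z =>
    cond z.2.2.2 (z.1 * modulus q + resetTime z.2.1 + z.2.2.1 - 2 * q)
      (z.1 * modulus q + z.2.2.1 - resetTime z.2.1 - 2 * q)
  have hsub : forbidden q ∩ Set.Icc 0 M ⊆ (S.image f : Finset ℕ) := by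
    rintro m ⟨⟨j, hj, i, hi, h⟩, -, hmM⟩
    have h1 := mul_modulus_le_of_mem (m := m) hi (by omega) hj
    have hj' : j ≤ 2 * M / modulus q :=
      (Nat.le_div_iff_mul_le (modulus_pos q)).2 (h1.trans (by omega))
    rw [Finset.coe_image]
    rcases h with h | h
    · refine ⟨(j, i, m + 2 * q - (j * modulus q + resetTime i), true), ?_, ?_⟩
      · simp only [S, Finset.coe_product, Set.mem_prod, Finset.mem_coe, Finset.mem_Icc,
          Finset.mem_range, Finset.mem_univ, and_true]
        omega
      · simp only [f, cond_true]
        omega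
    · refine ⟨(j, i, m + resetTime i + 2 * q - j * modulus q, false), ?_, ?_⟩
      · simp only [S, Finset.coe_product, Set.mem_prod, Finset.mem_coe, Finset.mem_Icc,
          Finset.mem_range, Finset.mem_univ, and_true]
        omega
      · simp only [f, cond_false]
        omega
  have hcard : (forbidden q ∩ Set.Icc 0 M).ncard ≤
      (2 * M / modulus q) * ((q + 1) * ((4 * q + 1) * 2)) := by
    calc _ ≤ ((S.image f : Finset ℕ) : Set ℕ).ncard :=
          Set.ncard_le_ncard hsub (Finset.finite_toSet _)
      _ = (S.image f).card := Set.ncard_coe_finset _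
      _ ≤ S.card := Finset.card_image_le
      _ = _ := by simp [S]
  calc modulus q * (forbidden q ∩ Set.Icc 0 M).ncard
      ≤ modulus q * ((2 * M / modulus q) * ((q + 1) * ((4 * q + 1) * 2))) := by gcongr
    _ = (modulus q * (2 * M / modulus q)) * ((q + 1) * ((4 * q + 1) * 2)) := by ring
    _ ≤ (2 * M) * ((q + 1) * ((4 * q + 1) * 2)) := Nat.mul_le_mul_right _ (Nat.mul_div_le _ _)
    _ ≤ (2 * M) * ((q + 1) * ((4 * q + 4) * 2)) := by gcongr; omega
    _ = 16 * (q + 1) ^ 2 * M := by ring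

lemma ncard_forbidden_succ_le (q M : ℕ) :
    ((forbidden (q + 1) ∩ Set.Icc 0 M).ncard : ℝ) ≤
      M / (modulus q : ℝ) ^ 2 * (1 / 2) ^ (q + 1) := by
  have h := modulus_mul_ncard_forbidden_le (q + 1) M
  rw [modulus_succ] at h
  set c := (forbidden (q + 1) ∩ Set.Icc 0 M).ncard
  have h1 : (16 * (q + 2) ^ 2) * (modulus q ^ 2 * 2 ^ (q + 1) * c) ≤ (16 * (q + 2) ^ 2) * M := by
    calc _ = modulus q ^ 2 * (16 * (q + 2) ^ 2 * 2 ^ (q + 1)) * c := by ring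
      _ ≤ _ := h
  have h2 : modulus q ^ 2 * 2 ^ (q + 1) * c ≤ M := Nat.le_of_mul_le_mul_left h1 (by positivity)
  have h3 : (modulus q : ℝ) ^ 2 * 2 ^ (q + 1) * c ≤ M := by exact_mod_cast h2
  have h4 : (0 : ℝ) < modulus q := by exact_mod_cast modulus_pos q
  rw [one_div, inv_pow, ← div_eq_mul_inv, div_div, le_div_iff₀ (by positivity)]
  linarith

/-! ### The return sets belong to Hindman's family -/

/-- Modulo `modulus q` the point is `2 * (b q - b p)`. It is at least `2 * modulus (q - 1)`, hence
exceeds `b q + 2 * q`, and at most `2 * b q`, hence stays below `modulus q - b q - 2 * q`. -/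
lemma not_mem_forbidden {p q Q l : ℕ} (hpq : p < q) (hqQ : q ≤ Q) :
    l * modulus Q + 2 * (resetTime Q - resetTime p) ∉ forbidden q := by
  rintro ⟨j, hj, i, hi, h⟩
  obtain ⟨c, hc⟩ := modulus_dvd hqQ
  obtain ⟨e, he⟩ := resetTime_eq_add_mul hqQ
  obtain ⟨r, rfl⟩ : ∃ r, q = r + 1 := ⟨q - 1, by omega⟩
  have h1 : l * modulus Q = l * c * modulus (r + 1) := by rw [hc]; ring
  have h2 := resetTime_strictMono.monotone (Nat.lt_succ_iff.1 hpq)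
  have h3 := resetTime_strictMono.monotone hi
  have h4 := resetTime_le_modulus r
  have h5 := resetTime_le_modulus (r + 1)
  have h6 := resetTime_succ r
  have h7 : (l * c + 2 * e) * modulus (r + 1) =
    l * c * modulus (r + 1) + 2 * (e * modulus (r + 1)) := by ring
  set N := modulus (r + 1)
  set u := l * modulus Q + 2 * (resetTime Q - resetTime p)
  have hu : u = (l * c + 2 * e) * N + 2 * (resetTime (r + 1) - resetTime p) := by omega
  rcases h with h | h
  · exact mul_ne_mul_add (N := N) (a := j) (c := l * c + 2 * e)
      (r := j * N - (l * c + 2 * e) * N) (by omega) (by omega) (by omega)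
  · exact mul_ne_mul_add (N := N) (a := j) (c := l * c + 2 * e)
      (r := j * N - (l * c + 2 * e) * N) (by omega) (by omega) (by omega)

lemma exists_mem_returnSet_or_mem_forbidden {p Q : ℕ} (hpQ : p < Q) (k : ℕ) :
    ∃ n ≤ 2 * modulus Q, k + n ∈ returnSet p ∨ ∃ q, Q < q ∧ k + n ∈ forbidden q := by
  set l := k / modulus Q
  have hl : k = l * modulus Q + k % modulus Q := by
    rw [mul_comm]; exact (Nat.div_add_mod k (modulus Q)).symm
  have hlt := Nat.mod_lt k (modulus_pos Q)
  -- This is a multiple of `modulus p`, because `b Q` and `b p` agree modulo `modulus p`; the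
  -- summand `modulus Q` puts it after `k`.
  set u := (l + 1) * modulus Q + 2 * (resetTime Q - resetTime p) with hu
  have hu' : u = l * modulus Q + modulus Q + 2 * (resetTime Q - resetTime p) := by
    rw [hu]; ring
  have hN := resetTime_le_modulus Q
  refine ⟨u - k, by omega, ?_⟩
  rw [show k + (u - k) = u by omega]
  by_contra! hcon
  refine hcon.1 ⟨?_, fun q hq => ?_⟩
  · obtain ⟨c, hc⟩ := modulus_dvd hpQ.le
    obtain ⟨e, he⟩ := resetTime_eq_add_mul hpQ.le
    have hc0 : c ≠ 0 := by
      rintro rfl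
      have := modulus_pos Q
      omega
    refine ⟨(l + 1) * c + 2 * e, ?_, ?_⟩
    · have : 1 ≤ (l + 1) * c := Nat.one_le_iff_ne_zero.2 (by positivity)
      omega
    · have h1 : resetTime Q - resetTime p = e * modulus p := by omega
      rw [hu, h1, hc]
      ring
  · rcases le_or_gt q Q with h | h
    · exact not_mem_forbidden hq h
    · exact hcon.2 q h

lemma sum_half_pow_le (Q R : ℕ) :
    ∑ q ∈ Finset.Ico Q R, (1 / 2 : ℝ) ^ (q + 1) ≤ (1 / 2) ^ Q := by
  rcases le_total R Q with h | h
  · rw [Finset.Ico_eq_empty_of_le h, Finset.sum_empty]; positivity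
  · have : ∑ q ∈ Finset.Ico Q R, (1 / 2 : ℝ) ^ (q + 1) = (1 / 2) ^ Q - (1 / 2) ^ R := by
      induction R, h using Nat.le_induction with
      | base => simp
      | succ R hR ih => rw [Finset.sum_Ico_succ_top hR, ih]; ring
    rw [this]
    have : (0 : ℝ) ≤ (1 / 2) ^ R := by positivity
    linarith

/-- Few points have a point of a forbidden set of large index shortly after them. -/
lemma ncard_near_forbidden_le (Q M : ℕ) :
    (({k | ∃ n ≤ 2 * modulus Q, ∃ q, Q < q ∧ k + n ∈ forbidden q} ∩ Set.Icc 0 M).ncard : ℝ) ≤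
      (M + 2 * modulus Q) * (1 / 2) ^ Q := by
  set N := modulus Q
  have hN16 : 16 ≤ N := by
    have := resetTime_le_modulus Q
    omega
  set R := M + 2 * N
  have hsub : {k | ∃ n ≤ 2 * N, ∃ q, Q < q ∧ k + n ∈ forbidden q} ∩ Set.Icc 0 M ⊆
      ⋃ n ∈ Finset.range (2 * N + 1), ⋃ q ∈ Finset.Ico Q R,
        (fun m => m - n) '' (forbidden (q + 1) ∩ Set.Icc 0 R) := by
    rintro k ⟨⟨n, hn, q, hq, hk⟩, -, hkM⟩
    have h1 := index_le_of_mem_forbidden hk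
    obtain ⟨r, rfl⟩ : ∃ r, q = r + 1 := ⟨q - 1, by omega⟩
    simp only [Set.mem_iUnion]
    exact ⟨n, Finset.mem_range.2 (by omega), r, Finset.mem_Ico.2 (by omega), k + n,
      ⟨hk, Nat.zero_le _, by omega⟩, Nat.add_sub_cancel _ _⟩
  have hfin : ∀ q, (forbidden q ∩ Set.Icc 0 R).Finite := fun q =>
    (Set.finite_Icc 0 R).subset Set.inter_subset_right
  have hcard : ({k | ∃ n ≤ 2 * N, ∃ q, Q < q ∧ k + n ∈ forbidden q} ∩ Set.Icc 0 M).ncard ≤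
      ∑ _n ∈ Finset.range (2 * N + 1), ∑ q ∈ Finset.Ico Q R,
        (forbidden (q + 1) ∩ Set.Icc 0 R).ncard := by
    refine (Set.ncard_le_ncard hsub ?_).trans ?_
    · exact Set.Finite.biUnion (Finset.finite_toSet _) fun n _ =>
        Set.Finite.biUnion (Finset.finite_toSet _) fun q _ => (hfin _).image _
    · refine (Finset.set_ncard_biUnion_le _ _).trans (Finset.sum_le_sum fun n _ => ?_)
      refine (Finset.set_ncard_biUnion_le _ _).trans (Finset.sum_le_sum fun q _ => ?_)
      exact Set.ncard_image_le (hfin _)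
  have hNpos : (16 : ℝ) ≤ N := by exact_mod_cast hN16
  have hterm : ∀ q ∈ Finset.Ico Q R, ((forbidden (q + 1) ∩ Set.Icc 0 R).ncard : ℝ) ≤
      R / (N : ℝ) ^ 2 * (1 / 2) ^ (q + 1) := by
    intro q hq
    refine (ncard_forbidden_succ_le q R).trans ?_
    have : N ≤ modulus q := Nat.le_of_dvd (modulus_pos q) (modulus_dvd (Finset.mem_Ico.1 hq).1)
    have : (N : ℝ) ≤ modulus q := by exact_mod_cast this
    gcongr
  calc (({k | ∃ n ≤ 2 * N, ∃ q, Q < q ∧ k + n ∈ forbidden q} ∩ Set.Icc 0 M).ncard : ℝ)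
      ≤ ∑ _n ∈ Finset.range (2 * N + 1), ∑ q ∈ Finset.Ico Q R,
        ((forbidden (q + 1) ∩ Set.Icc 0 R).ncard : ℝ) := by exact_mod_cast hcard
    _ ≤ ∑ _n ∈ Finset.range (2 * N + 1), ∑ q ∈ Finset.Ico Q R,
        (R / (N : ℝ) ^ 2 * (1 / 2) ^ (q + 1)) :=
        Finset.sum_le_sum fun _ _ => Finset.sum_le_sum hterm
    _ = ((2 * N + 1) / (N : ℝ) ^ 2) * (R * ∑ q ∈ Finset.Ico Q R, (1 / 2 : ℝ) ^ (q + 1)) := by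
        rw [Finset.sum_const, Finset.card_range, nsmul_eq_mul, ← Finset.mul_sum]
        push_cast
        ring
    _ ≤ 1 * (R * (1 / 2) ^ Q) := by
        have := sum_half_pow_le Q R
        gcongr
        rw [div_le_one (by positivity)]
        nlinarith
    _ = (M + 2 * N) * (1 / 2) ^ Q := by
        rw [one_mul]
        simp only [R]
        push_cast
        ring

lemma lowerDensity_le_one (A : Set ℕ) : lowerDensity A ≤ 1 := by
  have hle : ∀ N : ℕ, ((A ∩ Set.Icc 0 N).ncard : ℝ) / ((N : ℝ) + 1) ≤ 1 := by
    intro N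
    rw [div_le_one (by positivity)]
    have : (A ∩ Set.Icc 0 N).ncard ≤ (Set.Icc 0 N).ncard :=
      Set.ncard_le_ncard Set.inter_subset_right (Set.finite_Icc _ _)
    rw [← Finset.coe_Icc, Set.ncard_coe_finset, Nat.card_Icc] at this
    exact_mod_cast this
  refine liminf_le_of_frequently_le (Frequently.of_forall hle) ?_
  exact isBoundedUnder_of ⟨0, fun N => by positivity⟩

lemma le_lowerDensity_of_compl {A H : Set ℕ} {δ : ℝ} (hAH : Aᶜ ⊆ H)
    (hH : ∀ᶠ M : ℕ in atTop, ((H ∩ Set.Icc 0 M).ncard : ℝ) ≤ δ * (M + 1)) :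
    1 - δ ≤ lowerDensity A := by
  refine le_liminf_of_le ?_ ?_
  · refine IsBoundedUnder.isCoboundedUnder_ge (isBoundedUnder_of ⟨1, fun N => ?_⟩)
    rw [div_le_one (by positivity)]
    have : (A ∩ Set.Icc 0 N).ncard ≤ (Set.Icc 0 N).ncard :=
      Set.ncard_le_ncard Set.inter_subset_right (Set.finite_Icc _ _)
    rw [← Finset.coe_Icc, Set.ncard_coe_finset, Nat.card_Icc] at this
    exact_mod_cast this
  · filter_upwards [hH] with M hM
    rw [le_div_iff₀ (by positivity)]
    have h1 : Set.Icc 0 M ⊆ (A ∩ Set.Icc 0 M) ∪ (H ∩ Set.Icc 0 M) := by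
      intro k hk
      by_cases hkA : k ∈ A
      · exact Or.inl ⟨hkA, hk⟩
      · exact Or.inr ⟨hAH hkA, hk⟩
    have h2 : (Set.Icc 0 M).ncard ≤ (A ∩ Set.Icc 0 M).ncard + (H ∩ Set.Icc 0 M).ncard :=
      (Set.ncard_le_ncard h1 (((Set.finite_Icc 0 M).subset Set.inter_subset_right).union
        ((Set.finite_Icc 0 M).subset Set.inter_subset_right))).trans (Set.ncard_union_le _ _)
    rw [← Finset.coe_Icc, Set.ncard_coe_finset, Nat.card_Icc] at h2
    rw [Finset.coe_Icc] at h2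
    have h3 : (M : ℝ) + 1 ≤ (A ∩ Set.Icc 0 M).ncard + (H ∩ Set.Icc 0 M).ncard := by
      exact_mod_cast h2
    linarith

/-- Every superset of a return set belongs to Hindman's family. -/
lemma mem_hindmanFamily_of_returnSet_subset {p : ℕ} {A : Set ℕ} (hA : returnSet p ⊆ A) :
    A ∈ hindmanFamily := by
  change Tendsto _ _ _
  rw [tendsto_order]
  refine ⟨fun c hc => ?_, fun c hc => Eventually.of_forall fun N =>
    (lowerDensity_le_one _).trans_lt hc⟩
  -- The factor `2` absorbs the overhang: `M + 2 * modulus Q ≤ 2 * M` for large `M`.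
  obtain ⟨Q, hQp, hQ⟩ : ∃ Q, p < Q ∧ 2 * (1 / 2 : ℝ) ^ Q < 1 - c := by
    have h1 : Tendsto (fun Q : ℕ => 2 * (1 / 2 : ℝ) ^ Q) atTop (𝓝 (2 * 0)) :=
      (tendsto_pow_atTop_nhds_zero_of_lt_one (by norm_num) (by norm_num)).const_mul 2
    have h2 := h1.eventually_lt_const (show (2 : ℝ) * 0 < 1 - c by linarith)
    exact ((eventually_gt_atTop p).and h2).exists
  filter_upwards [eventually_ge_atTop (2 * modulus Q)] with N hN
  refine (show c < 1 - 2 * (1 / 2 : ℝ) ^ Q by linarith).trans_le ?_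
  refine le_lowerDensity_of_compl
    (H := {k | ∃ n ≤ 2 * modulus Q, ∃ q, Q < q ∧ k + n ∈ forbidden q}) ?_ ?_
  · intro k hk
    obtain ⟨n, hn, h | h⟩ := exists_mem_returnSet_or_mem_forbidden hQp k
    · refine absurd ?_ hk
      simp only [Set.mem_iUnion]
      exact ⟨n, ⟨Nat.zero_le _, hn.trans hN⟩, hA h⟩
    · exact ⟨n, hn, h⟩
  · filter_upwards [eventually_ge_atTop (2 * modulus Q)] with M hM
    refine (ncard_near_forbidden_le Q M).trans ?_
    have hM' : (2 : ℝ) * modulus Q ≤ M := by exact_mod_cast hM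
    have : (0 : ℝ) < (1 / 2) ^ Q := by positivity
    nlinarith

/-! ### The space of null sequences -/

section NullSequences

variable {𝕜 : Type*} [RCLike 𝕜]

/-- The element of `C₀(ℕ, 𝕜)` given by a null sequence. -/
def nullSequence (f : ℕ → 𝕜) (hf : Tendsto f atTop (𝓝 0)) : C₀(ℕ, 𝕜) where
  toFun := f
  continuous_toFun := continuous_of_discreteTopology
  zero_at_infty' := by rwa [cocompact_eq_atTop]

@[simp]
lemma nullSequence_apply (f : ℕ → 𝕜) (hf : Tendsto f atTop (𝓝 0)) (n : ℕ) :
    nullSequence f hf n = f n := rfl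

lemma tendsto_apply_atTop (x : C₀(ℕ, 𝕜)) : Tendsto (fun n => x n) atTop (𝓝 0) := by
  have := x.zero_at_infty'
  rwa [cocompact_eq_atTop] at this

lemma norm_apply_le (x : C₀(ℕ, 𝕜)) (n : ℕ) : ‖x n‖ ≤ ‖x‖ := x.toBCF.norm_coe_le_norm n

lemma norm_le_of_forall_apply {x : C₀(ℕ, 𝕜)} {C : ℝ} (hC : 0 ≤ C) (h : ∀ n, ‖x n‖ ≤ C) :
    ‖x‖ ≤ C := by
  rw [← ZeroAtInftyContinuousMap.norm_toBCF_eq_norm]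
  exact (BoundedContinuousFunction.norm_le hC).2 h

lemma continuous_apply_nat (n : ℕ) : Continuous fun x : C₀(ℕ, 𝕜) => x n :=
  (LipschitzWith.of_dist_le_mul (K := 1) fun x y => by
    rw [NNReal.coe_one, one_mul, dist_eq_norm, dist_eq_norm]
    exact norm_apply_le (x - y) n).continuous

end NullSequences

/-! ### The weight products and the shift -/

/-- The product of the first `n` weights: it doubles at each step and returns to `1` at the
reset times. -/
noncomputable def weightProduct (n : ℕ) : ℝ := 2 ^ elapsed n

lemma weightProduct_pos (n : ℕ) : 0 < weightProduct n := by unfold weightProduct; positivity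

lemma weightProduct_succ_le (n : ℕ) : weightProduct (n + 1) ≤ 2 * weightProduct n := by
  unfold weightProduct
  rw [← pow_succ']
  exact pow_le_pow_right₀ one_le_two (elapsed_succ_le n)

lemma weightProduct_resetTime (k : ℕ) : weightProduct (resetTime k) = 1 := by
  rw [weightProduct, elapsed_resetTime, pow_zero]

lemma weightProduct_zero : weightProduct 0 = 1 := weightProduct_resetTime 0

lemma weightProduct_resetTime_add_le (k s : ℕ) : weightProduct (resetTime k + s) ≤ 2 ^ s := by
  induction s with
  | zero => rw [Nat.add_zero, weightProduct_resetTime, pow_zero]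
  | succ s ih =>
    rw [← add_assoc, pow_succ']
    exact (weightProduct_succ_le _).trans (by linarith)

section Shift

variable (𝕜 : Type*) [RCLike 𝕜]

/-- The weights of the shift. -/
noncomputable def weight (n : ℕ) : 𝕜 := ((weightProduct n / weightProduct (n - 1) : ℝ) : 𝕜)

lemma weight_ne_zero (n : ℕ) : weight 𝕜 n ≠ 0 := by
  rw [weight, Ne, RCLike.ofReal_eq_zero]
  exact (div_pos (weightProduct_pos _) (weightProduct_pos _)).ne'

lemma norm_weight_succ_le (n : ℕ) : ‖weight 𝕜 (n + 1)‖ ≤ 2 := by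
  rw [weight, Nat.add_sub_cancel, RCLike.norm_ofReal,
    abs_of_pos (div_pos (weightProduct_pos _) (weightProduct_pos _)),
    div_le_iff₀ (weightProduct_pos _)]
  exact weightProduct_succ_le n

/-- The weighted backward shift with weights `weight`. -/
noncomputable def weightedShift : C₀(ℕ, 𝕜) →L[𝕜] C₀(ℕ, 𝕜) :=
  LinearMap.mkContinuous
    { toFun := fun x => nullSequence (fun n => weight 𝕜 (n + 1) * x (n + 1)) (by
        refine squeeze_zero_norm (a := fun n => 2 * ‖x (n + 1)‖) (fun n => ?_) ?_
        · rw [norm_mul]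
          exact mul_le_mul_of_nonneg_right (norm_weight_succ_le 𝕜 n) (norm_nonneg _)
        · have h := ((tendsto_add_atTop_iff_nat 1).2 (tendsto_apply_atTop x)).norm.const_mul 2
          simpa using h)
      map_add' := fun x y => by
        ext n
        simp [mul_add]
      map_smul' := fun c x => by
        ext n
        simp [mul_left_comm] }
    2 fun x => norm_le_of_forall_apply (by positivity) fun n => by
      rw [LinearMap.coe_mk, AddHom.coe_mk, nullSequence_apply, norm_mul]
      exact mul_le_mul (norm_weight_succ_le 𝕜 n) (norm_apply_le x _) (norm_nonneg _) zero_le_two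

variable {𝕜}

lemma weightedShift_apply (x : C₀(ℕ, 𝕜)) (n : ℕ) :
    weightedShift 𝕜 x n = weight 𝕜 (n + 1) * x (n + 1) := rfl

lemma isWeightedBackwardShift_weightedShift :
    IsWeightedBackwardShift (weight 𝕜) (weightedShift 𝕜) :=
  ⟨fun n _ => weight_ne_zero 𝕜 n, weightedShift_apply⟩

/-- The coordinates of a sequence after the change of variables that turns the weighted shift
into the unweighted one. -/
noncomputable def coordinate (x : C₀(ℕ, 𝕜)) (n : ℕ) : 𝕜 := (weightProduct n : 𝕜) * x n

lemma coordinate_weightedShift (x : C₀(ℕ, 𝕜)) (n : ℕ) :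
    coordinate (weightedShift 𝕜 x) n = coordinate x (n + 1) := by
  have h : (weightProduct n : 𝕜) ≠ 0 := RCLike.ofReal_ne_zero.2 (weightProduct_pos n).ne'
  rw [coordinate, coordinate, weightedShift_apply, weight, Nat.add_sub_cancel, ← mul_assoc,
    RCLike.ofReal_div, mul_div_cancel₀ _ h]

lemma coordinate_iterate (x : C₀(ℕ, 𝕜)) (m n : ℕ) :
    coordinate ((weightedShift 𝕜)^[m] x) n = coordinate x (n + m) := by
  induction m generalizing x with
  | zero => rfl
  | succ m ih => rw [Function.iterate_succ_apply, ih, coordinate_weightedShift, add_assoc]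

lemma apply_eq_coordinate_div (x : C₀(ℕ, 𝕜)) (n : ℕ) :
    x n = coordinate x n / (weightProduct n : 𝕜) := by
  have h : (weightProduct n : 𝕜) ≠ 0 := RCLike.ofReal_ne_zero.2 (weightProduct_pos n).ne'
  rw [coordinate, mul_div_cancel_left₀ _ h]

lemma eq_zero_of_coordinate {x : C₀(ℕ, 𝕜)} (h : ∀ n, coordinate x n = 0) : x = 0 := by
  ext n
  rw [apply_eq_coordinate_div, h, zero_div]
  rfl

/-- The coordinates tend to zero along the reset times shifted by a constant. -/
lemma tendsto_coordinate_resetTime (x : C₀(ℕ, 𝕜)) (s : ℕ) :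
    Tendsto (fun k => coordinate x (s + resetTime k)) atTop (𝓝 0) := by
  refine squeeze_zero_norm (a := fun k => 2 ^ s * ‖x (s + resetTime k)‖) (fun k => ?_) ?_
  · rw [coordinate, norm_mul, RCLike.norm_ofReal, abs_of_pos (weightProduct_pos _), add_comm]
    exact mul_le_mul_of_nonneg_right (weightProduct_resetTime_add_le k s) (norm_nonneg _)
  · have h : Tendsto (fun k => s + resetTime k) atTop atTop :=
      tendsto_atTop_mono (fun k => Nat.le_add_left _ s) resetTime_strictMono.tendsto_atTop
    simpa using ((tendsto_apply_atTop x).comp h).norm.const_mul (2 ^ s)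

/-! ### Failure of chaos, of mixing, and of invariant measures -/

/-- The coordinates of such an eigenvector have constant modulus, yet tend to `0` along the reset
times. -/
lemma not_hasEigenvalue_weightedShift {c : 𝕜} (hc : ‖c‖ = 1) :
    ¬ Module.End.HasEigenvalue (weightedShift 𝕜 : C₀(ℕ, 𝕜) →ₗ[𝕜] C₀(ℕ, 𝕜)) c := by
  intro h
  obtain ⟨x, hx⟩ := h.exists_hasEigenvector
  refine hx.2 (eq_zero_of_coordinate ?_)
  have hx1 : weightedShift 𝕜 x = c • x := hx.apply_eq_smul
  have hstep : ∀ n, ‖coordinate x (n + 1)‖ = ‖coordinate x n‖ := by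
    intro n
    have : coordinate (c • x) n = c * coordinate x n := by
      simp only [coordinate, ZeroAtInftyContinuousMap.smul_apply, smul_eq_mul]
      ring
    rw [← coordinate_weightedShift, hx1, this, norm_mul, hc, one_mul]
  have hconst : ∀ n, ‖coordinate x n‖ = ‖coordinate x 0‖ := by
    intro n
    induction n with
    | zero => rfl
    | succ n ih => rw [hstep, ih]
  have hlim := (tendsto_coordinate_resetTime x 0).norm
  simp only [hconst, norm_zero] at hlim
  have h0 := tendsto_nhds_unique hlim tendsto_const_nhds
  intro n
  rw [← norm_eq_zero, hconst, ← h0]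

/-- The coordinates are `n`-periodic, so each value recurs in every window of length `n` starting at
a reset time, where all values tend to `0`. -/
lemma periodicPts_weightedShift_subset :
    Function.periodicPts (weightedShift 𝕜) ⊆ {(0 : C₀(ℕ, 𝕜))} := by
  rintro x ⟨n, hn, hx⟩
  have hper : ∀ j l, coordinate x (j + l * n) = coordinate x j := by
    intro j l
    have h : (weightedShift 𝕜)^[l * n] x = x := (hx.const_mul l).eq
    rw [← coordinate_iterate, h]
  refine eq_zero_of_coordinate fun j => ?_
  have hbound : ∀ s, s < n → Tendsto (fun k => ‖coordinate x (s + resetTime k)‖) atTop (𝓝 0) :=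
    fun s _ => by simpa using (tendsto_coordinate_resetTime x s).norm
  have hsum : Tendsto (fun k => ∑ s ∈ Finset.range n, ‖coordinate x (s + resetTime k)‖) atTop
      (𝓝 0) := by
    simpa using tendsto_finsetSum (Finset.range n) fun s hs => hbound s (Finset.mem_range.1 hs)
  have hle : ∀ k, ‖coordinate x j‖ ≤ ∑ s ∈ Finset.range n, ‖coordinate x (s + resetTime k)‖ := by
    intro k
    set b := resetTime k
    have hmod := Nat.mod_lt (j + b * n - b) hn
    have hdiv := Nat.div_add_mod (j + b * n - b) n
    have hb : b ≤ b * n := Nat.le_mul_of_pos_right b hn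
    have heq : coordinate x j = coordinate x ((j + b * n - b) % n + b) := by
      rw [← hper j b, ← hper ((j + b * n - b) % n + b) ((j + b * n - b) / n)]
      congr 1
      rw [mul_comm ((j + b * n - b) / n) n]
      omega
    rw [heq]
    exact Finset.single_le_sum (f := fun s => ‖coordinate x (s + b)‖)
      (fun s _ => norm_nonneg _) (Finset.mem_range.2 hmod)
  have := ge_of_tendsto' hsum hle
  exact norm_le_zero_iff.1 this

lemma exists_one_lt_norm_apply_zero : ∃ x : C₀(ℕ, 𝕜), 1 < ‖x 0‖ := by
  refine ⟨nullSequence (fun n => if n = 0 then 2 else 0) ?_, ?_⟩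
  · refine tendsto_const_nhds.congr' ?_
    filter_upwards [eventually_ne_atTop 0] with n hn
    rw [if_neg hn]
  · rw [nullSequence_apply, if_pos rfl, RCLike.norm_two]
    exact one_lt_two

lemma not_isChaotic_weightedShift : ¬ IsChaotic (weightedShift 𝕜) := by
  rintro ⟨-, hd⟩
  obtain ⟨x, hx⟩ := exists_one_lt_norm_apply_zero (𝕜 := 𝕜)
  have h1 : x ∈ closure {(0 : C₀(ℕ, 𝕜))} :=
    closure_mono periodicPts_weightedShift_subset (hd x)
  rw [closure_singleton, Set.mem_singleton_iff] at h1
  rw [h1, ZeroAtInftyContinuousMap.zero_apply, norm_zero] at hx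
  linarith

/-- At a reset time the shift moves an entry to position `0` without changing its size, so it cannot
carry the unit ball to vectors with large first entry. -/
lemma not_isTopologicallyMixing_weightedShift : ¬ IsTopologicallyMixing (weightedShift 𝕜) := by
  intro h
  obtain ⟨N, hN⟩ := h (Metric.ball 0 1) {x | 1 < ‖x 0‖} Metric.isOpen_ball
    ⟨0, Metric.mem_ball_self one_pos⟩
    (isOpen_lt continuous_const (continuous_apply_nat 0).norm) exists_one_lt_norm_apply_zero
  obtain ⟨_, ⟨u, hu, rfl⟩, hv⟩ := hN _ (resetTime_strictMono.le_apply (x := N))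
  have h1 : ((weightedShift 𝕜)^[resetTime N] u) 0 = u (resetTime N) := by
    rw [apply_eq_coordinate_div, coordinate_iterate, coordinate, zero_add,
      weightProduct_resetTime, weightProduct_zero]
    simp
  rw [Set.mem_ofPred_eq, h1] at hv
  rw [mem_ball_zero_iff] at hu
  linarith [norm_apply_le u (resetTime N)]

variable [MeasurableSpace C₀(ℕ, 𝕜)] [BorelSpace C₀(ℕ, 𝕜)]

/-- The only invariant Borel probability measure is the Dirac measure at `0`. -/
lemma eq_dirac_of_measurePreserving_weightedShift (μ : Measure C₀(ℕ, 𝕜)) [IsProbabilityMeasure μ]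
    (hμ : MeasurePreserving (weightedShift 𝕜) μ μ) : μ = Measure.dirac 0 := by
  have hcont : ∀ n, Continuous fun x : C₀(ℕ, 𝕜) => coordinate x n := fun n =>
    continuous_const.mul (continuous_apply_nat n)
  have hzero : ∀ n, ∀ᵐ x ∂μ, coordinate x n = 0 := by
    intro n
    -- By invariance all these coordinates have the same law, so convergence in measure to `0`
    -- forces that law to be concentrated at `0`.
    have hlim : TendstoInMeasure μ (fun k x => coordinate x (n + resetTime k)) atTop
        (fun _ => (0 : 𝕜)) := by
      refine tendstoInMeasure_of_tendsto_ae (fun k => ?_)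
        (Eventually.of_forall fun x => tendsto_coordinate_resetTime x n)
      borelize 𝕜
      exact (hcont _).measurable.aestronglyMeasurable
    rw [tendstoInMeasure_iff_norm] at hlim
    have hnull : ∀ ε : ℝ, 0 < ε → μ {x | ε ≤ ‖coordinate x n‖} = 0 := by
      intro ε hε
      have hmeas : MeasurableSet {x : C₀(ℕ, 𝕜) | ε ≤ ‖coordinate x n‖} :=
        (isClosed_le continuous_const (hcont n).norm).measurableSet
      have hinv : ∀ k, μ {x | ε ≤ ‖coordinate x (n + resetTime k) - 0‖} =
          μ {x | ε ≤ ‖coordinate x n‖} := by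
        intro k
        rw [← (hμ.iterate (resetTime k)).measure_preimage hmeas.nullMeasurableSet]
        congr 1
        ext x
        simp only [Set.mem_preimage, Set.mem_ofPred_eq, coordinate_iterate, sub_zero]
      have h := hlim ε hε
      simp only [hinv] at h
      exact tendsto_nhds_unique tendsto_const_nhds h
    have hall : ∀ᵐ x ∂μ, ∀ m : ℕ, ‖coordinate x n‖ < 1 / ((m : ℝ) + 1) := by
      refine ae_all_iff.2 fun m => ?_
      rw [ae_iff]
      simp only [not_lt]
      exact hnull _ (by positivity)
    filter_upwards [hall] with x hx
    refine norm_le_zero_iff.1 (ge_of_tendsto' tendsto_one_div_add_atTop_nhds_zero_nat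
      fun m => (hx m).le)
  have hae : (id : C₀(ℕ, 𝕜) → C₀(ℕ, 𝕜)) =ᵐ[μ] fun _ => 0 := by
    filter_upwards [ae_all_iff.2 hzero] with x hx
    exact eq_zero_of_coordinate hx
  calc μ = μ.map id := Measure.map_id.symm
    _ = μ.map (fun _ => 0) := Measure.map_congr hae
    _ = Measure.dirac 0 := by rw [Measure.map_const, measure_univ, one_smul]

end Shift

/-! ### Very frequent hypercyclicity -/

section VeryFrequent

variable {𝕜 : Type*} [RCLike 𝕜]

variable (𝕜) in
/-- A sequence of finitely supported targets that is dense in the coordinates of `C₀(ℕ, 𝕜)`, with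
a slow growth of the supports and of the norms. -/
lemma exists_dense_targets : ∃ v : ℕ → ℕ → 𝕜, (∀ q j, q < j → v q j = 0) ∧
    (∀ q j, ‖v q j‖ ≤ 2 ^ q) ∧ ∀ (x : C₀(ℕ, 𝕜)) (ε : ℝ), 0 < ε → ∃ q ≥ 1, (1 / 2 : ℝ) ^ q < ε ∧
      ∀ j, ‖v q j / (weightProduct j : 𝕜) - x j‖ ≤ ε := by
  classical
  set D := TopologicalSpace.denseSeq 𝕜
  let l : ℕ → List ℕ := fun a => (Encodable.decode (α := List ℕ) a).getD []
  let c : ℕ → ℕ → 𝕜 := fun a j => if j < (l a).length then D ((l a).getD j 0) else 0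
  -- The index `q` codes a pair: a finite list of dense points and a free second entry. The latter
  -- lets each list recur at arbitrarily large `q`, where the truncation no longer affects it.
  refine ⟨fun q j => if j ≤ q ∧ ‖c q.unpair.1 j‖ ≤ 2 ^ q then c q.unpair.1 j else 0,
    fun q j h => if_neg fun h' => by omega, fun q j => ?_, fun x ε hε => ?_⟩
  · beta_reduce
    split_ifs with h
    · exact h.2
    · rw [norm_zero]; positivity
  obtain ⟨K, hK⟩ := Metric.tendsto_atTop.1 (tendsto_apply_atTop x) ε hε
  have happrox : ∀ j, ∃ i, ‖D i - (weightProduct j : 𝕜) * x j‖ < ε * weightProduct j := by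
    intro j
    obtain ⟨i, hi⟩ := (TopologicalSpace.denseRange_denseSeq 𝕜).exists_dist_lt
      ((weightProduct j : 𝕜) * x j) (mul_pos hε (weightProduct_pos j))
    exact ⟨i, by rwa [← dist_eq_norm, dist_comm]⟩
  choose i hi using happrox
  obtain ⟨Q, hQ1, hQK, hQε, hQD⟩ : ∃ Q : ℕ, 1 ≤ Q ∧ K ≤ Q ∧ (1 / 2 : ℝ) ^ Q < ε ∧
      ∀ j ∈ Finset.range K, ‖D (i j)‖ ≤ 2 ^ Q := by
    have h1 : Tendsto (fun Q : ℕ => (1 / 2 : ℝ) ^ Q) atTop (𝓝 0) :=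
      tendsto_pow_atTop_nhds_zero_of_lt_one (by norm_num) (by norm_num)
    have h2 : Tendsto (fun Q : ℕ => (2 : ℝ) ^ Q) atTop atTop :=
      tendsto_pow_atTop_atTop_of_one_lt one_lt_two
    exact ((eventually_ge_atTop 1).and ((eventually_ge_atTop K).and
      ((h1.eventually_lt_const hε).and ((Finset.eventually_all _).2 fun j _ =>
        h2.eventually_ge_atTop ‖D (i j)‖)))).exists
  set a := Encodable.encode ((List.range K).map i)
  have hl : l a = (List.range K).map i := by simp [l, a]
  have hq : Q ≤ Nat.pair a Q := Nat.right_le_pair a Q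
  refine ⟨Nat.pair a Q, hQ1.trans hq,
    (pow_le_pow_of_le_one (by norm_num) (by norm_num) hq).trans_lt hQε, fun j => ?_⟩
  have hW : (weightProduct j : 𝕜) ≠ 0 := RCLike.ofReal_ne_zero.2 (weightProduct_pos j).ne'
  simp only [Nat.unpair_pair]
  by_cases hj : j < K
  · have hc : c a j = D (i j) := by
      simp only [c, hl, List.length_map, List.length_range, if_pos hj]
      congr 1
      simp [List.getD, hj]
    have hn : ‖c a j‖ ≤ 2 ^ Nat.pair a Q := by
      rw [hc]
      exact (hQD j (Finset.mem_range.2 hj)).trans (pow_le_pow_right₀ one_le_two hq)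
    rw [if_pos ⟨by omega, hn⟩, hc]
    have heq : D (i j) / (weightProduct j : 𝕜) - x j =
        (D (i j) - (weightProduct j : 𝕜) * x j) / (weightProduct j : 𝕜) := by
      rw [sub_div, mul_div_cancel_left₀ _ hW]
    rw [heq, norm_div, RCLike.norm_ofReal, abs_of_pos (weightProduct_pos j),
      div_le_iff₀ (weightProduct_pos j)]
    exact (hi j).le
  · have hc : c a j = 0 := by simp [c, hl, hj]
    have hx := hK j (not_lt.1 hj)
    rw [dist_zero_right] at hx
    simpa [hc] using hx.le

/-- Copies of the targets can be placed at all the points of the return sets. -/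
lemma exists_placement (v : ℕ → ℕ → 𝕜) : ∃ y : ℕ → 𝕜,
    (∀ p m t, 1 ≤ p → m ∈ returnSet p → t ≤ p → y (m + t) = v p t) ∧
    ∀ i, y i = 0 ∨ ∃ p m t, 1 ≤ p ∧ m ∈ returnSet p ∧ t ≤ p ∧ i = m + t ∧ y i = v p t := by
  have h : ∀ i, ∃ c : 𝕜, (∀ p m t, 1 ≤ p → m ∈ returnSet p → t ≤ p → i = m + t → c = v p t) ∧
      (c = 0 ∨ ∃ p m t, 1 ≤ p ∧ m ∈ returnSet p ∧ t ≤ p ∧ i = m + t ∧ c = v p t) := by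
    intro i
    by_cases hi : ∃ p m t, 1 ≤ p ∧ m ∈ returnSet p ∧ t ≤ p ∧ i = m + t
    · obtain ⟨p, m, t, hp, hm, ht, hi⟩ := hi
      refine ⟨v p t, fun q n s hq hn hs his => ?_, Or.inr ⟨p, m, t, hp, hm, ht, hi, rfl⟩⟩
      obtain ⟨rfl, -, rfl⟩ := returnSet_block_unique hp hq hm hn ht hs (hi.symm.trans his)
      rfl
    · exact ⟨0, fun p m t hp hm ht hi' => absurd ⟨p, m, t, hp, hm, ht, hi'⟩ hi, Or.inl rfl⟩
  choose y hy1 hy2 using h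
  exact ⟨y, fun p m t hp hm ht => hy1 _ p m t hp hm ht rfl, hy2⟩

lemma norm_div_weightProduct_le {c : 𝕜} {p K M i : ℕ} (hc : ‖c‖ ≤ 2 ^ p) (hp : p ≤ M) (hK : K ≤ M)
    (hM : 2 * M ≤ elapsed i) : ‖c / (weightProduct i : 𝕜)‖ ≤ (1 / 2) ^ K := by
  rw [norm_div, RCLike.norm_ofReal, abs_of_pos (weightProduct_pos i),
    div_le_iff₀ (weightProduct_pos i)]
  have h1 : (2 : ℝ) ^ p * 2 ^ K ≤ weightProduct i := by
    rw [weightProduct, ← pow_add]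
    exact pow_le_pow_right₀ one_le_two (by omega)
  calc ‖c‖ ≤ 2 ^ p := hc
    _ = (1 / 2) ^ K * (2 ^ p * 2 ^ K) := by
      rw [mul_comm ((2 : ℝ) ^ p), ← mul_assoc, ← mul_pow]
      norm_num
    _ ≤ _ := by gcongr

lemma isVeryFrequentlyHypercyclic_weightedShift :
    IsVeryFrequentlyHypercyclic (weightedShift 𝕜) := by
  obtain ⟨v, hsupp, hnorm, hdense⟩ := exists_dense_targets 𝕜
  obtain ⟨y, hy, hy'⟩ := exists_placement v
  have hlim : Tendsto (fun i => y i / (weightProduct i : 𝕜)) atTop (𝓝 0) := by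
    refine Metric.tendsto_atTop.2 fun ε hε => ?_
    obtain ⟨K, hK⟩ := exists_pow_lt_of_lt_one hε (show (1 / 2 : ℝ) < 1 by norm_num)
    -- Beyond this time the last reset has index `k ≥ K + 1`, so `k - 1 ≥ K` in `le_elapsed`.
    refine ⟨resetTime (K + 1), fun i hi => ?_⟩
    rw [dist_zero_right]
    refine lt_of_le_of_lt ?_ hK
    rcases hy' i with h0 | ⟨p, m, t, hp, hm, ht, rfl, hv⟩
    · rw [h0, zero_div, norm_zero]; positivity
    · obtain ⟨k, hk, hmax⟩ := exists_eq_resetTime_add_elapsed (m + t)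
      have hKk := hmax _ hi
      rw [hv]
      exact norm_div_weightProduct_le (hnorm p t) (le_max_left p (k - 1))
        ((show K ≤ k - 1 by omega).trans (le_max_right _ _)) (le_elapsed hp hm ht hk)
  set x : C₀(ℕ, 𝕜) := nullSequence _ hlim
  have hxy : ∀ i, coordinate x i = y i := fun i =>
    mul_div_cancel₀ _ (RCLike.ofReal_ne_zero.2 (weightProduct_pos i).ne')
  have herr : ∀ q, 1 ≤ q → ∀ n ∈ returnSet q, ∀ j,
      ‖((weightedShift 𝕜)^[n] x) j - v q j / (weightProduct j : 𝕜)‖ ≤ (1 / 2) ^ q := by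
    intro q hq n hn j
    rw [apply_eq_coordinate_div, coordinate_iterate, hxy, ← sub_div]
    have hpow : (0 : ℝ) ≤ (1 / 2) ^ q := by positivity
    rcases le_or_gt j q with hj | hj
    · rw [add_comm j n, hy q n j hq hn hj, sub_self, zero_div, norm_zero]
      exact hpow
    rw [hsupp q j hj, sub_zero]
    rcases hy' (j + n) with h0 | ⟨p, m, t, hp, hm, ht, hi, hv⟩
    · rw [h0, zero_div, norm_zero]
      exact hpow
    rcases le_or_gt m n with hmn | hmn
    · obtain ⟨rfl, rfl, -⟩ := returnSet_block_unique hp hq hm hn (t := t - j) (s := 0)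
        (by omega) (Nat.zero_le _) (by omega)
      omega
    · have hel := le_elapsed_sub hp hm hn hmn ht
      rw [show m - n + t = j by omega] at hel
      rw [hv]
      exact norm_div_weightProduct_le (hnorm p t) (le_max_left p q) (le_max_right p q) hel
  refine ⟨x, fun U hU ⟨z, hz⟩ => ?_⟩
  obtain ⟨ε, hε, hball⟩ := Metric.isOpen_iff.1 hU z hz
  obtain ⟨q, hq, hqε, hqz⟩ := hdense z (ε / 3) (by positivity)
  refine mem_hindmanFamily_of_returnSet_subset (p := q) fun n hn => hball ?_
  rw [mem_ball_iff_norm]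
  refine lt_of_le_of_lt (norm_le_of_forall_apply (C := ε / 3 + ε / 3) (by positivity)
    fun j => ?_) (by linarith)
  calc ‖((weightedShift 𝕜)^[n] x - z) j‖
      = ‖(((weightedShift 𝕜)^[n] x) j - v q j / (weightProduct j : 𝕜)) +
          (v q j / (weightProduct j : 𝕜) - z j)‖ := by
        rw [sub_add_sub_cancel]
        rfl
    _ ≤ (1 / 2) ^ q + ε / 3 := (norm_add_le _ _).trans (add_le_add (herr q hq n hn j) (hqz j))
    _ ≤ ε / 3 + ε / 3 := by linarith

end VeryFrequent

end LinearDynamics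

theorem theorem7p4 (𝕜 : Type*) [RCLike 𝕜] [MeasurableSpace C₀(ℕ, 𝕜)] [BorelSpace C₀(ℕ, 𝕜)] :
    ∃ (w : ℕ → 𝕜) (T : C₀(ℕ, 𝕜) →L[𝕜] C₀(ℕ, 𝕜)),
      LinearDynamics.IsWeightedBackwardShift w T ∧
      LinearDynamics.IsVeryFrequentlyHypercyclic T ∧
      ¬ LinearDynamics.IsChaotic T ∧
      (∀ c : 𝕜, ‖c‖ = 1 → ¬ Module.End.HasEigenvalue (T : C₀(ℕ, 𝕜) →ₗ[𝕜] C₀(ℕ, 𝕜)) c) ∧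
      ¬ LinearDynamics.IsTopologicallyMixing T ∧
      (∀ μ : Measure C₀(ℕ, 𝕜), IsGaussian μ → MeasurePreserving T μ μ →
        μ = Measure.dirac 0) :=
  ⟨LinearDynamics.weight 𝕜, LinearDynamics.weightedShift 𝕜,
    LinearDynamics.isWeightedBackwardShift_weightedShift,
    LinearDynamics.isVeryFrequentlyHypercyclic_weightedShift,
    LinearDynamics.not_isChaotic_weightedShift,
    fun _ hc => LinearDynamics.not_hasEigenvalue_weightedShift hc,
    LinearDynamics.not_isTopologicallyMixing_weightedShift,
    fun μ _ hinv => LinearDynamics.eq_dirac_of_measurePreserving_weightedShift μ hinv⟩
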